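/- Let $n\ge 1$ be an integer, let $\mathbb{R}_+^n=\{x\in\mathbb{R}^n : x_i>0 \text{ for } i=1,\dots,n\}$, and let $k_1,\dots,k_n>1$ be real numbers, not necessarily integers. Let $\varphi:\mathbb{R}_+^n\to\mathbb{R}$ be a $C^\infty$-smooth function such that $$(x_1,\dots,x_n)\mapsto \varphi\left(x_1^{k_1},\dots,x_n^{k_n}\right)$$ is convex on $\mathbb{R}_+^n$, and let $\mu$ be the Borel measure on $\mathbb{R}_+^n$ with density $\exp(-\varphi)$ with respect to Lebesgue measure (possibly of infinite total mass). Let $f:\mathbb{R}_+^n\to\mathbb{R}$ be a $\mu$-integrable, locally Lipschitz function with $\int f\,d\mu=0$. Then $$\int_{\mathbb{R}_+^n} f^2\,d\mu\;\le\;\int_{\mathbb{R}_+^n}\sum_{i=1}^n \frac{k_i^2}{k_i-1}\,x_i^2\,\left|\partial^i f(x)\right|^2\,d\mu(x),$$ where $\partial^i f=\partial f/\partial x_i$ is the partial derivative with respect to the $i$-th variable (defined almost everywhere), and both sides are understood as elements of $[0,\infty]$. -/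

import Mathlib

open MeasureTheory
open scoped ContDiff ENNReal

/-- The open orthant of all points of `ℝⁿ` with positive coordinates. -/
def posOrthant (n : ℕ) : Set (Fin n → ℝ) := {x | ∀ i, 0 < x i}

/-- The partial derivative of `f` with respect to the `i`-th variable at `x`, that is, the
derivative at `t = 0` of `t ↦ f (x + t eᵢ)`. -/
noncomputable def partialD {n : ℕ} (i : Fin n) (f : (Fin n → ℝ) → ℝ) (x : Fin n → ℝ) : ℝ :=
  lineDeriv ℝ f x (Pi.single i 1)

/-- The Borel measure on the open orthant with density `exp (-φ)` with respect to Lebesgue measure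
(extended by zero to `ℝⁿ`; only the values of `φ` on the orthant matter). -/
noncomputable def orthantMeasure {n : ℕ} (φ : (Fin n → ℝ) → ℝ) : Measure (Fin n → ℝ) :=
  (volume.restrict (posOrthant n)).withDensity (fun x => ENNReal.ofReal (Real.exp (-φ x)))

/-! Substitute `x_i = y_i ^ k_i`. The measure becomes one with density `exp (-W)`, where `W` is the
convex function `φ (y_1 ^ k_1, …)` minus the logarithm of the Jacobian. That logarithm contributes
`-(k_i - 1) log y_i`, so `W` is convex with modulus `(k_i - 1) / y_i ^ 2` in each coordinate. The
Brascamp-Lieb inequality bounds the variance of `g y = f (y ^ k)` by `∫ ∑ y_i ^ 2 / (k_i - 1) |∂_i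
g| ^ 2`, and the chain rule turns this weight into `k_i ^ 2 / (k_i - 1) x_i ^ 2`.

Brascamp-Lieb is obtained from the midpoint Prékopa-Leindler inequality (`prekopaLeindler`). It is
applied to `exp (t G - W)`, `exp (-t G - W)` and `exp (t ^ 2 r_t - W)`, where `r_t` is a
sup-convolution whose quadratic penalty is paid for by the convexity of `W`
(`prekopaLeindler_withDensity`). Comparing the terms of order `t ^ 2` as `t → 0` gives the variance
on the left and the limit of `r_t`, a Legendre transform in the gradient of `G`, on the right
(`measure_mul_integral_sq_le`, `eventually_supConv_le`). Only a midpoint form of convexity enters,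
so `W` is never differentiated.

The argument runs on bounded boxes, where everything is finite. Exhausting the orthant removes the
restriction: integrability and mean zero make the squared-mean term vanish, even when the total mass
is infinite. -/

/-! ### Brunn-Minkowski and Prékopa-Leindler on the line. -/

open scoped Pointwise in
theorem volume_add_volume_le_volume_add {K L : Set ℝ} (hK : IsCompact K) (hL : IsCompact L)
    (hK0 : K.Nonempty) (hL0 : L.Nonempty) : volume K + volume L ≤ volume (K + L) := by
  have ha := hK.sSup_mem hK0
  have hb := hL.sInf_mem hL0
  set a := sSup K
  set b := sInf L
  have h1 : volume ((fun x => x + b) '' K) = volume K := by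
    simp [Set.image_add_right, measure_preimage_add_right]
  have h2 : volume ((fun x => a + x) '' L) = volume L := by
    simp [Set.image_add_left, measure_preimage_add]
  -- The translates `K + b` and `a + L` both lie in `K + L`. Since `a` is the maximum of `K` and `b`
  -- the minimum of `L`, they can meet only at `a + b`.
  have hdisj : AEDisjoint volume ((fun x => x + b) '' K) ((fun x => a + x) '' L) := by
    refine measure_mono_null (t := {a + b}) ?_ (by simp)
    rintro _ ⟨⟨x, hx, rfl⟩, ⟨y, hy, hxy⟩⟩
    have h3 : x ≤ a := le_csSup hK.bddAbove hx
    have h4 : b ≤ y := csInf_le hL.bddBelow hy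
    simp only at hxy
    simp only [Set.mem_singleton_iff]
    linarith
  have hm : MeasurableSet ((fun x => a + x) '' L) :=
    (hL.image (by fun_prop)).measurableSet
  rw [← h1, ← h2, ← measure_union₀ hm.nullMeasurableSet hdisj]
  refine measure_mono (Set.union_subset ?_ ?_)
  · rintro _ ⟨x, hx, rfl⟩
    exact Set.add_mem_add hx hb
  · rintro _ ⟨x, hx, rfl⟩
    exact Set.add_mem_add ha hx

open scoped Pointwise in
/-- The one-dimensional Brunn-Minkowski inequality for midpoints. -/
theorem volume_add_volume_le_two_mul_volume {A B C : Set ℝ} (hA : MeasurableSet A)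
    (hB : MeasurableSet B) (hA0 : A.Nonempty) (hB0 : B.Nonempty)
    (h : ∀ x ∈ A, ∀ y ∈ B, (1 / 2 : ℝ) * (x + y) ∈ C) :
    volume A + volume B ≤ 2 * volume C := by
  obtain ⟨a, ha⟩ := hA0
  obtain ⟨b, hb⟩ := hB0
  have hC : volume ((fun x : ℝ => (1 / 2 : ℝ) * x) ⁻¹' C) = 2 * volume C := by
    rw [Real.volume_preimage_mul_left (by norm_num)]
    norm_num
  have key : ∀ K ⊆ A, IsCompact K → ∀ L ⊆ B, IsCompact L → volume K + volume L ≤ 2 * volume C := by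
    intro K hKA hK L hLB hL
    -- The approximating compact sets may be empty; adjoining `a` and `b` makes them nonempty.
    have h1 := volume_add_volume_le_volume_add (hK.insert a) (hL.insert b)
      (Set.insert_nonempty _ _) (Set.insert_nonempty _ _)
    refine (add_le_add (measure_mono (Set.subset_insert a K))
      (measure_mono (Set.subset_insert b L))).trans (h1.trans ?_)
    rw [← hC]
    refine measure_mono ?_
    rintro _ ⟨x, hx, y, hy, rfl⟩
    exact h x (Set.insert_subset ha hKA hx) y (Set.insert_subset hb hLB hy)
  rw [hA.measure_eq_iSup_isCompact, hB.measure_eq_iSup_isCompact]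
  simp only [iSup_and']
  refine ENNReal.biSup_add_biSup_le' (ι := Set ℝ) (κ := Set ℝ)
    (p := fun K => K ⊆ A ∧ IsCompact K) (q := fun K => K ⊆ B ∧ IsCompact K)
    ⟨∅, by simp⟩ ⟨∅, by simp⟩ ?_
  intro K hK L hL
  exact key K hK.1 hK.2 L hL.1 hL.2

/-- Layer-cake integration of Brunn-Minkowski over superlevel sets. Both functions having supremum 1
is essential: their level sets are nonempty for every `t < 1` and empty for `t ≥ 1`, so
Brunn-Minkowski never meets exactly one empty set. -/
theorem lintegral_add_lintegral_le_of_mul_le_sq {U V H : ℝ → ℝ} (hU : Measurable U)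
    (hV : Measurable V) (hH : Measurable H) (hU0 : ∀ x, 0 ≤ U x) (hV0 : ∀ x, 0 ≤ V x)
    (hH0 : ∀ x, 0 ≤ H x) (hU1 : ∀ x, U x ≤ 1) (hV1 : ∀ x, V x ≤ 1)
    (hUs : ∀ r < 1, ∃ x, r < U x) (hVs : ∀ r < 1, ∃ x, r < V x)
    (h : ∀ x y, U x * V y ≤ H ((1 / 2 : ℝ) * (x + y)) ^ 2) :
    (∫⁻ x, ENNReal.ofReal (U x)) + ∫⁻ x, ENNReal.ofReal (V x) ≤ 2 * ∫⁻ x, ENNReal.ofReal (H x) := by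
  rw [lintegral_eq_lintegral_meas_lt _ (Filter.Eventually.of_forall hU0) hU.aemeasurable,
    lintegral_eq_lintegral_meas_lt _ (Filter.Eventually.of_forall hV0) hV.aemeasurable,
    lintegral_eq_lintegral_meas_lt _ (Filter.Eventually.of_forall hH0) hH.aemeasurable]
  have hmeas : ∀ F : ℝ → ℝ, Measurable fun t => volume {x | t < F x} := fun F =>
    Antitone.measurable fun s t hst => measure_mono fun x (hx : t < F x) => lt_of_le_of_lt hst hx
  rw [← lintegral_add_left (hmeas U), ← lintegral_const_mul _ (hmeas H)]
  refine setLIntegral_mono ((hmeas H).const_mul _) fun t ht => ?_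
  have ht0 : (0 : ℝ) < t := ht
  by_cases h1 : t < 1
  · refine volume_add_volume_le_two_mul_volume (measurableSet_lt measurable_const hU)
      (measurableSet_lt measurable_const hV) (hUs t h1) (hVs t h1) fun x hx y hy => ?_
    have hx' : t < U x := hx
    have hy' : t < V y := hy
    have h2 : t ^ 2 < H ((1 / 2 : ℝ) * (x + y)) ^ 2 := by
      refine lt_of_lt_of_le ?_ (h x y)
      nlinarith
    exact lt_of_pow_lt_pow_left₀ 2 (hH0 _) h2
  · have e1 : {x | t < U x} = ∅ := by
      ext x; simpa using (hU1 x).trans (not_lt.1 h1)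
    have e2 : {x | t < V x} = ∅ := by
      ext x; simpa using (hV1 x).trans (not_lt.1 h1)
    simp [e1, e2]

theorem ENNReal.mul_le_sq_of_add_le_two_mul {a b c : ℝ≥0∞} (h : a + b ≤ 2 * c) :
    a * b ≤ c ^ 2 := by
  rcases eq_or_ne c ⊤ with rfl | hc
  · simp
  have hab : a + b ≠ ⊤ := ne_top_of_le_ne_top (ENNReal.mul_ne_top (by simp) hc) h
  have ha : a ≠ ⊤ := fun h => hab (by simp [h])
  have hb : b ≠ ⊤ := fun h => hab (by simp [h])
  lift a to NNReal using ha
  lift b to NNReal using hb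
  lift c to NNReal using hc
  norm_cast at h ⊢
  have h' : (a : ℝ) + b ≤ 2 * c := by exact_mod_cast h
  have : (a : ℝ) * b ≤ (c : ℝ) ^ 2 := by nlinarith [a.2, b.2, c.2, sq_nonneg ((a : ℝ) - b)]
  exact_mod_cast this

/-- Dividing `u` and `v` by their suprema `a`, `b`, and `h` by `√(a b)`, preserves the hypothesis
and reduces to the additive inequality; AM-GM then makes it multiplicative. -/
theorem prekopaLeindler_real_of_bounded {u v h : ℝ → ℝ≥0∞} (hu : Measurable u) (hv : Measurable v)
    (hh : Measurable h) {N : ℝ≥0∞} (hN : N ≠ ⊤) (huN : ∀ x, u x ≤ N) (hvN : ∀ x, v x ≤ N)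
    (H : ∀ x y, u x * v y ≤ h ((1 / 2 : ℝ) * (x + y)) ^ 2) :
    (∫⁻ x, u x) * ∫⁻ x, v x ≤ (∫⁻ x, h x) ^ 2 := by
  have normalize : ∀ w : ℝ → ℝ≥0∞, Measurable w → (∀ x, w x ≤ N) → (∫⁻ x, w x) ≠ 0 →
      ∃ a : ℝ, ∃ U : ℝ → ℝ, 0 < a ∧ Measurable U ∧ (∀ x, 0 ≤ U x) ∧ (∀ x, U x ≤ 1) ∧
        (∀ r < 1, ∃ x, r < U x) ∧ ∀ x, w x = ENNReal.ofReal a * ENNReal.ofReal (U x) := by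
    intro w hw hwN hw0
    have hat : (⨆ x, w x) ≠ ⊤ := ne_top_of_le_ne_top hN (iSup_le hwN)
    have hle : ∀ x, w x ≤ ⨆ x, w x := fun x => le_iSup w x
    have hlt : ∀ c < ⨆ x, w x, ∃ x, c < w x := fun c hc => lt_iSup_iff.1 hc
    have ha0 : (⨆ x, w x) ≠ 0 := by
      intro h0
      apply hw0
      have : ∀ x, w x = 0 := fun x => le_antisymm (h0 ▸ hle x) zero_le
      simp [this]
    generalize (⨆ x, w x) = a at hat hle hlt ha0
    have hapos : 0 < a.toReal := ENNReal.toReal_pos ha0 hat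
    have hwt : ∀ x, w x ≠ ⊤ := fun x => ne_top_of_le_ne_top hat (hle x)
    refine ⟨a.toReal, fun x => (w x).toReal / a.toReal, hapos, hw.ennreal_toReal.div_const _,
      fun x => by positivity, fun x => ?_, fun r hr => ?_, fun x => ?_⟩
    · exact div_le_one_of_le₀ (ENNReal.toReal_mono hat (hle x)) hapos.le
    · obtain ⟨x, hx⟩ := hlt (ENNReal.ofReal (r * a.toReal)) (by
        conv_rhs => rw [← ENNReal.ofReal_toReal hat]
        rw [ENNReal.ofReal_lt_ofReal_iff hapos]
        nlinarith)
      refine ⟨x, ?_⟩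
      rw [lt_div_iff₀ hapos]
      by_contra hcon
      push Not at hcon
      exact absurd hx (not_lt.2 (by
        rw [← ENNReal.ofReal_toReal (hwt x)]; exact ENNReal.ofReal_le_ofReal hcon))
    · rw [← ENNReal.ofReal_mul hapos.le, mul_div_cancel₀ _ hapos.ne', ENNReal.ofReal_toReal (hwt x)]
  by_cases hu0 : (∫⁻ x, u x) = 0
  · simp [hu0]
  by_cases hv0 : (∫⁻ x, v x) = 0
  · simp [hv0]
  obtain ⟨a, U, ha, hU, hU0, hU1, hUs, huU⟩ := normalize u hu huN hu0
  obtain ⟨b, V, hb, hV, hV0, hV1, hVs, hvV⟩ := normalize v hv hvN hv0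
  set c : ℝ := Real.sqrt (a * b)
  have hc : 0 < c := Real.sqrt_pos.2 (by positivity)
  have hc2 : c ^ 2 = a * b := Real.sq_sqrt (by positivity)
  have hc0 : ENNReal.ofReal c ≠ 0 := by simpa using hc
  -- Truncation at 1 makes `F` finite and costs nothing, because `U x * V y ≤ 1`.
  let F : ℝ → ℝ≥0∞ := fun x => min 1 (h x / ENNReal.ofReal c)
  have hF1 : ∀ x, F x ≠ ⊤ := fun x => ne_top_of_le_ne_top ENNReal.one_ne_top (min_le_left _ _)
  have hF : Measurable F := measurable_const.min (hh.div_const _)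
  have key := lintegral_add_lintegral_le_of_mul_le_sq hU hV hF.ennreal_toReal hU0 hV0
    (fun x => ENNReal.toReal_nonneg) hU1 hV1 hUs hVs fun x y => by
      have h1 : ENNReal.ofReal (U x * V y) ≤ F ((1 / 2 : ℝ) * (x + y)) ^ 2 := by
        simp only [F]
        rcases min_choice 1 (h ((1 / 2 : ℝ) * (x + y)) / ENNReal.ofReal c) with e | e <;> rw [e]
        · rw [one_pow, ENNReal.ofReal_le_one]
          exact mul_le_one₀ (hU1 x) (hV0 y) (hV1 y)
        · rw [div_eq_mul_inv, mul_pow, ← ENNReal.inv_pow, ← div_eq_mul_inv,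
            ENNReal.le_div_iff_mul_le (by simp [hc0]) (by simp),
            ← ENNReal.ofReal_pow hc.le, hc2]
          refine le_trans (le_of_eq ?_) (H x y)
          rw [huU, hvV, ENNReal.ofReal_mul (hU0 x), ENNReal.ofReal_mul ha.le]
          ring
      rw [← ENNReal.toReal_pow]
      rw [← ENNReal.ofReal_le_iff_le_toReal (by simp [hF1])]
      exact h1
  have key2 := ENNReal.mul_le_sq_of_add_le_two_mul key
  calc (∫⁻ x, u x) * ∫⁻ x, v x
      = ENNReal.ofReal c ^ 2 *
          ((∫⁻ x, ENNReal.ofReal (U x)) * ∫⁻ x, ENNReal.ofReal (V x)) := by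
        simp_rw [huU, hvV]
        rw [lintegral_const_mul _ hU.ennreal_ofReal, lintegral_const_mul _ hV.ennreal_ofReal,
          ← ENNReal.ofReal_pow hc.le, hc2, ENNReal.ofReal_mul ha.le]
        ring
    _ ≤ ENNReal.ofReal c ^ 2 * (∫⁻ x, ENNReal.ofReal (F x).toReal) ^ 2 := by gcongr
    _ = (∫⁻ x, ENNReal.ofReal c * F x) ^ 2 := by
        rw [lintegral_const_mul _ hF, mul_pow]
        simp_rw [ENNReal.ofReal_toReal (hF1 _)]
    _ ≤ (∫⁻ x, h x) ^ 2 := by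
        gcongr with x
        calc ENNReal.ofReal c * F x ≤ ENNReal.ofReal c * (h x / ENNReal.ofReal c) := by
              gcongr; exact min_le_right _ _
          _ = h x := ENNReal.mul_div_cancel hc0 (by simp)

theorem prekopaLeindler_real {u v h : ℝ → ℝ≥0∞} (hu : Measurable u) (hv : Measurable v)
    (hh : Measurable h) (H : ∀ x y, u x * v y ≤ h ((1 / 2 : ℝ) * (x + y)) ^ 2) :
    (∫⁻ x, u x) * ∫⁻ x, v x ≤ (∫⁻ x, h x) ^ 2 := by
  have hsup : ∀ w : ℝ → ℝ≥0∞, Measurable w →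
      Filter.Tendsto (fun N : ℕ => ∫⁻ x, min (w x) N) Filter.atTop (nhds (∫⁻ x, w x)) := by
    intro w hw
    refine lintegral_tendsto_of_tendsto_of_monotone
      (fun N => (hw.min measurable_const).aemeasurable)
      (Filter.Eventually.of_forall fun x N M hNM => ?_) (Filter.Eventually.of_forall fun x => ?_)
    · exact min_le_min_left _ (by exact_mod_cast hNM)
    · have := (tendsto_const_nhds (x := w x)).min ENNReal.tendsto_nat_nhds_top
      simpa using this
  have hb : ∀ N : ℕ, (∫⁻ x, min (u x) N) * ∫⁻ x, min (v x) N ≤ (∫⁻ x, h x) ^ 2 := fun N =>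
    prekopaLeindler_real_of_bounded (hu.min measurable_const) (hv.min measurable_const) hh
      (ENNReal.natCast_ne_top N) (fun x => min_le_right _ _) (fun x => min_le_right _ _)
      fun x y => (mul_le_mul' (min_le_left _ _) (min_le_left _ _)).trans (H x y)
  by_cases hu0 : (∫⁻ x, u x) = 0
  · simp [hu0]
  by_cases hv0 : (∫⁻ x, v x) = 0
  · simp [hv0]
  -- The zero cases are excluded above because multiplication on `ℝ≥0∞` is discontinuous at `0 * ⊤`.
  exact le_of_tendsto (ENNReal.Tendsto.mul (hsup u hu) (Or.inl hu0) (hsup v hv) (Or.inl hv0))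
    (Filter.Eventually.of_forall hb)

/-! ### Prékopa-Leindler in dimension `n`, by slicing off one coordinate. -/

theorem lintegral_pi_succ {n : ℕ} {u : (Fin (n + 1) → ℝ) → ℝ≥0∞} (hu : Measurable u) :
    ∫⁻ x, u x = ∫⁻ s : ℝ, ∫⁻ y : Fin n → ℝ, u (Fin.cons s y) := by
  have h := (volume_preserving_piFinSuccAbove (fun _ : Fin (n + 1) => ℝ) 0).symm
  rw [← h.lintegral_comp hu, Measure.volume_eq_prod, lintegral_prod]
  · simp [MeasurableEquiv.piFinSuccAbove_symm_apply, Fin.insertNthEquiv]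
  · exact (hu.comp (MeasurableEquiv.measurable _)).aemeasurable

theorem measurable_finCons {n : ℕ} :
    Measurable fun p : ℝ × (Fin n → ℝ) => (Fin.cons p.1 p.2 : Fin (n + 1) → ℝ) := by
  rw [measurable_pi_iff]
  intro i
  refine Fin.cases ?_ (fun j => ?_) i
  · simpa using measurable_fst
  · simp only [Fin.cons_succ]
    fun_prop

/-- The Prékopa-Leindler inequality for midpoints. -/
theorem prekopaLeindler {n : ℕ} {u v h : (Fin n → ℝ) → ℝ≥0∞} (hu : Measurable u)
    (hv : Measurable v) (hh : Measurable h)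
    (H : ∀ x y, u x * v y ≤ h ((1 / 2 : ℝ) • (x + y)) ^ 2) :
    (∫⁻ x, u x) * ∫⁻ x, v x ≤ (∫⁻ x, h x) ^ 2 := by
  induction n with
  | zero =>
    simp only [lintegral_unique, Measure.volume_pi_eq_dirac (0 : Fin 0 → ℝ), measure_univ, mul_one]
    have := H default default
    rw [Subsingleton.elim ((1 / 2 : ℝ) • ((default : Fin 0 → ℝ) + default)) default] at this
    convert this
  | succ n ih =>
    rw [lintegral_pi_succ hu, lintegral_pi_succ hv, lintegral_pi_succ hh]
    have hm : ∀ w : (Fin (n + 1) → ℝ) → ℝ≥0∞, Measurable w →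
        Measurable fun s : ℝ => ∫⁻ y : Fin n → ℝ, w (Fin.cons s y) := fun w hw =>
      Measurable.lintegral_prod_right' (hw.comp measurable_finCons)
    have hs : ∀ (w : (Fin (n + 1) → ℝ) → ℝ≥0∞) (s : ℝ), Measurable w →
        Measurable fun y : Fin n → ℝ => w (Fin.cons s y) := fun w s hw =>
      (hw.comp measurable_finCons).comp measurable_prodMk_left
    refine prekopaLeindler_real (hm u hu) (hm v hv) (hm h hh) fun s t => ?_
    refine ih (hs u s hu) (hs v t hv) (hs h _ hh) fun x y => ?_
    refine (H _ _).trans (le_of_eq ?_)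
    congr 2
    ext i
    refine Fin.cases ?_ (fun j => ?_) i <;> simp [mul_add]

/-! ### Second-order expansion of exponential integrals. -/

theorem one_add_add_sq_sub_cube_le_exp {x : ℝ} (hx : |x| ≤ 1) :
    1 + x + x ^ 2 / 2 - |x| ^ 3 ≤ Real.exp x := by
  have h := (abs_le.1 (Real.exp_bound hx (n := 3) (by norm_num))).1
  simp only [Finset.sum_range_succ, Finset.sum_range_zero, Nat.factorial] at h
  norm_num at h
  have : 0 ≤ |x| ^ 3 := by positivity
  linarith

theorem integral_exp_ge {α : Type*} [MeasurableSpace α] {ν : Measure α} [IsFiniteMeasure ν]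
    {g : α → ℝ} (hg : AEStronglyMeasurable g ν) {G : ℝ} (hgG : ∀ᵐ x ∂ν, |g x| ≤ G) {s : ℝ}
    (hs : |s| * G ≤ 1) :
    ν.real Set.univ + s * (∫ x, g x ∂ν) + s ^ 2 / 2 * (∫ x, g x ^ 2 ∂ν)
      - |s| ^ 3 * (G ^ 3 * ν.real Set.univ) ≤ ∫ x, Real.exp (s * g x) ∂ν := by
  have ig : Integrable g ν := Integrable.of_bound hg G (by simpa using hgG)
  have ig2 : Integrable (fun x => g x ^ 2) ν := by
    refine Integrable.of_bound (hg.pow 2) (G ^ 2) ?_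
    filter_upwards [hgG] with x hx
    rw [Real.norm_eq_abs, abs_pow]
    exact pow_le_pow_left₀ (abs_nonneg _) hx 2
  have habs : ∀ᵐ x ∂ν, |s * g x| ≤ |s| * G := by
    filter_upwards [hgG] with x hx
    rw [abs_mul]
    exact mul_le_mul_of_nonneg_left hx (abs_nonneg s)
  have ie : Integrable (fun x => Real.exp (s * g x)) ν := by
    refine Integrable.of_bound
      (Real.continuous_exp.comp_aestronglyMeasurable (hg.const_mul s)) (Real.exp (|s| * G)) ?_
    filter_upwards [habs] with x hx
    rw [Real.norm_eq_abs, Real.abs_exp]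
    exact Real.exp_le_exp.2 ((le_abs_self _).trans hx)
  have i1 : Integrable (fun x => 1 + s * g x) ν := (integrable_const _).add (ig.const_mul _)
  have i2 : Integrable (fun x => 1 + s * g x + s ^ 2 / 2 * g x ^ 2) ν := i1.add (ig2.const_mul _)
  have e : ν.real Set.univ + s * (∫ x, g x ∂ν) + s ^ 2 / 2 * (∫ x, g x ^ 2 ∂ν)
      - |s| ^ 3 * (G ^ 3 * ν.real Set.univ)
      = ∫ x, (1 + s * g x + s ^ 2 / 2 * g x ^ 2 - |s| ^ 3 * G ^ 3) ∂ν := by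
    rw [integral_sub i2 (integrable_const _), integral_add i1 (ig2.const_mul _),
      integral_add (integrable_const _) (ig.const_mul _), integral_const_mul, integral_const_mul]
    simp only [integral_const, smul_eq_mul]
    ring
  rw [e]
  refine integral_mono_ae (i2.sub (integrable_const _)) ie ?_
  filter_upwards [habs] with x hx
  have h1 := one_add_add_sq_sub_cube_le_exp (hx.trans hs)
  have h2 : |s * g x| ^ 3 ≤ (|s| * G) ^ 3 := pow_le_pow_left₀ (abs_nonneg _) hx 3
  nlinarith

/-- The second-order expansion at `t = 0` of
`(∫ exp (t g)) (∫ exp (-t g)) ≤ (∫ exp (t² q_t))²`. -/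
theorem measure_mul_integral_sq_le {α : Type*} [MeasurableSpace α] {ν : Measure α}
    [IsFiniteMeasure ν] {g q : α → ℝ} {r : ℝ → α → ℝ} {G K : ℝ}
    (hg : AEStronglyMeasurable g ν) (hgG : ∀ᵐ x ∂ν, |g x| ≤ G)
    (hq : AEStronglyMeasurable q ν) (hq0 : ∀ᵐ x ∂ν, 0 ≤ q x) (hqK : ∀ᵐ x ∂ν, q x ≤ K)
    (hr : ∀ t > 0, AEStronglyMeasurable (r t) ν) (hr0 : ∀ t > 0, ∀ᵐ x ∂ν, 0 ≤ r t x)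
    (hrK : ∀ t > 0, ∀ᵐ x ∂ν, r t x ≤ K)
    (hlim : ∀ᵐ x ∂ν, ∀ ε > 0, ∀ᶠ t in nhdsWithin 0 (Set.Ioi 0), r t x ≤ q x + ε)
    (H : ∀ t > 0, (∫ x, Real.exp (t * g x) ∂ν) * (∫ x, Real.exp (-t * g x) ∂ν)
      ≤ (∫ x, Real.exp (t ^ 2 * r t x) ∂ν) ^ 2) :
    ν.real Set.univ * ∫ x, g x ^ 2 ∂ν
      ≤ (∫ x, g x ∂ν) ^ 2 + 2 * ν.real Set.univ * ∫ x, q x ∂ν := by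
  have hiq : Integrable q ν := by
    refine Integrable.of_bound hq K ?_
    filter_upwards [hq0, hqK] with x h1 h2
    rwa [Real.norm_of_nonneg h1]
  set M := ν.real Set.univ
  set m := ∫ x, g x ∂ν
  set S := ∫ x, g x ^ 2 ∂ν
  set Q := ∫ x, q x ∂ν
  -- Only an upper bound on the limit of `r t` is assumed, so the error is measured by the positive
  -- part of `r t - q`; it tends to 0 by dominated convergence.
  let D : ℝ → ℝ := fun t => ∫ x, max (r t x - q x) 0 ∂ν
  have hDm : ∀ t > 0, AEStronglyMeasurable (fun x => max (r t x - q x) 0) ν := fun t ht =>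
    ((hr t ht).sub hq).sup aestronglyMeasurable_const
  have hDb : ∀ t > 0, ∀ᵐ x ∂ν, ‖max (r t x - q x) 0‖ ≤ |K| := fun t ht => by
    filter_upwards [hq0, hrK t ht] with x h1 h2
    rw [Real.norm_of_nonneg (le_max_right _ _)]
    exact max_le (by linarith [le_abs_self K]) (abs_nonneg K)
  set l : Filter ℝ := nhdsWithin 0 (Set.Ioi 0) with hl
  have hpos : ∀ᶠ t : ℝ in l, 0 < t := self_mem_nhdsWithin
  have hD : Filter.Tendsto D l (nhds 0) := by
    rw [show nhds (0 : ℝ) = nhds (∫ _, (0 : ℝ) ∂ν) by simp]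
    refine tendsto_integral_filter_of_dominated_convergence (fun _ => |K|)
      (hpos.mono hDm) (hpos.mono hDb) (integrable_const _) ?_
    filter_upwards [hlim] with x hx
    rw [Metric.tendsto_nhds]
    intro ε hε
    filter_upwards [hx (ε / 2) (half_pos hε)] with t ht
    rw [Real.dist_eq, sub_zero, abs_of_nonneg (le_max_right _ _)]
    exact max_lt (by linarith) hε
  have hM : 0 ≤ M := measureReal_nonneg
  have upper : ∀ t > 0, t ^ 2 * K ≤ 1 →
      ∫ x, Real.exp (t ^ 2 * r t x) ∂ν ≤ M + t ^ 2 * (Q + D t + t ^ 2 * (K ^ 2 * M)) := by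
    intro t ht htK
    have hiD : Integrable (fun x => max (r t x - q x) 0) ν :=
      Integrable.of_bound (hDm t ht) _ (hDb t ht)
    have j1 : Integrable (fun x => q x + max (r t x - q x) 0) ν := hiq.add hiD
    have j2 : Integrable (fun x => q x + max (r t x - q x) 0 + t ^ 2 * K ^ 2) ν :=
      j1.add (integrable_const _)
    have e : M + t ^ 2 * (Q + D t + t ^ 2 * (K ^ 2 * M))
        = ∫ x, (1 + t ^ 2 * (q x + max (r t x - q x) 0 + t ^ 2 * K ^ 2)) ∂ν := by
      rw [integral_add (integrable_const _) (j2.const_mul _),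
        integral_const_mul, integral_add j1 (integrable_const _), integral_add hiq hiD]
      simp only [integral_const, smul_eq_mul]
      ring
    rw [e]
    refine integral_mono_of_nonneg (Filter.Eventually.of_forall fun x => (Real.exp_pos _).le)
      ((integrable_const _).add (j2.const_mul _)) ?_
    filter_upwards [hr0 t ht, hrK t ht] with x h0 hK
    have ht2 : 0 < t ^ 2 := by positivity
    have h1 : t ^ 2 * r t x ≤ t ^ 2 * K := by gcongr
    have h2 : 0 ≤ t ^ 2 * r t x := by positivity
    have h3 := (abs_le.1 (Real.abs_exp_sub_one_sub_id_le
      (x := t ^ 2 * r t x) (by rw [abs_of_nonneg h2]; linarith))).2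
    have h4 : (t ^ 2 * r t x) ^ 2 ≤ (t ^ 2 * K) ^ 2 := pow_le_pow_left₀ h2 h1 2
    have h5 : t ^ 2 * r t x ≤ t ^ 2 * (q x + max (r t x - q x) 0) := by
      gcongr
      linarith [le_max_left (r t x - q x) 0]
    nlinarith
  rcases hM.eq_or_lt with hM0 | hM0
  · rw [← hM0]
    simp only [zero_mul, mul_zero, add_zero]
    positivity
  have hid : Filter.Tendsto (fun t : ℝ => t) l (nhds 0) :=
    Filter.tendsto_id.mono_left nhdsWithin_le_nhds
  have ev1 : ∀ᶠ t : ℝ in l, t * G < 1 := by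
    refine (Filter.Tendsto.eventually_lt_const (v := 0 * G) (by simp) (hid.mul_const G))
  have ev2 : ∀ᶠ t : ℝ in l, t ^ 2 * K < 1 := by
    refine (Filter.Tendsto.eventually_lt_const (v := 0 ^ 2 * K) (by simp) ((hid.pow 2).mul_const K))
  -- Positivity of the lower bound for `∫ exp (-t g)` is what allows the two lower bounds to be
  -- multiplied.
  have ev3 : ∀ᶠ t : ℝ in l, 0 < M - t * m + t ^ 2 / 2 * S - t ^ 3 * (G ^ 3 * M) := by
    have hc : Continuous fun t : ℝ => M - t * m + t ^ 2 / 2 * S - t ^ 3 * (G ^ 3 * M) := by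
      fun_prop
    exact ((hc.tendsto 0).mono_left nhdsWithin_le_nhds).eventually_const_lt (by simpa using hM0)
  let X : ℝ → ℝ := fun t => Q + D t + t ^ 2 * (K ^ 2 * M)
  have hX : Filter.Tendsto X l (nhds (Q + 0 + 0 ^ 2 * (K ^ 2 * M))) :=
    (hD.const_add Q).add ((hid.pow 2).mul_const _)
  have hleft : Filter.Tendsto (fun t => M * S - 2 * M * (t * (G ^ 3 * M)) - m ^ 2) l
      (nhds (M * S - 2 * M * (0 * (G ^ 3 * M)) - m ^ 2)) :=
    (((hid.mul_const _).const_mul _).const_sub _).sub_const _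
  have hright : Filter.Tendsto (fun t => 2 * M * X t + t ^ 2 * X t ^ 2) l
      (nhds (2 * M * (Q + 0 + 0 ^ 2 * (K ^ 2 * M))
        + 0 ^ 2 * (Q + 0 + 0 ^ 2 * (K ^ 2 * M)) ^ 2)) :=
    (hX.const_mul _).add ((hid.pow 2).mul (hX.pow 2))
  have hle := le_of_tendsto_of_tendsto hleft hright (by
    filter_upwards [hpos, ev1, ev2, ev3] with t ht h1 h2 h3
    have hU := upper t ht h2.le
    have hA := integral_exp_ge hg hgG (s := t) (by rw [abs_of_pos ht]; exact h1.le)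
    have hB := integral_exp_ge hg hgG (s := -t) (by rw [abs_neg, abs_of_pos ht]; exact h1.le)
    have hH := H t ht
    rw [abs_of_pos ht] at hA
    rw [abs_neg, abs_of_pos ht] at hB
    have h0 : 0 ≤ ∫ x, Real.exp (t * g x) ∂ν := integral_nonneg fun x => (Real.exp_pos _).le
    have h0' : 0 ≤ ∫ x, Real.exp (t ^ 2 * r t x) ∂ν := integral_nonneg fun x => (Real.exp_pos _).le
    have hAB := mul_le_mul hA hB (by linarith) h0
    have hU2 := pow_le_pow_left₀ h0' hU 2
    have hchain := (hAB.trans hH).trans hU2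
    have ht2 : 0 < t ^ 2 := by positivity
    -- The product of the lower bounds has the form `(A + t m) (A - t m)`. Expanding `A ^ 2` around
    -- `M ^ 2` leaves this square, which is discarded; `M ^ 2` cancels and the rest is divided by `t
    -- ^ 2`.
    have hsq : 0 ≤ (t * S / 2 - t ^ 2 * (G ^ 3 * M)) ^ 2 := sq_nonneg _
    refine le_of_mul_le_mul_left ?_ ht2
    have hsq' : 0 ≤ t ^ 2 * (t * S / 2 - t ^ 2 * (G ^ 3 * M)) ^ 2 := by positivity
    simp only [X]
    linear_combination hchain + hsq')
  linarith

/-! ### The sup-convolution and its limit at points of differentiability. -/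

/-- The difference quotient appearing in the sup-convolution that follows. -/
noncomputable def quotientSubQuadratic {n : ℕ} (a : Fin n → ℝ) (G : (Fin n → ℝ) → ℝ) (t : ℝ)
    (z e : Fin n → ℝ) : ℝ :=
  (G (z + t • (z * e)) - G (z - t • (z * e))) / (2 * t) - ∑ i, a i / 2 * e i ^ 2

/-- The rescaled sup-convolution of `G`, which tends to `∑ zᵢ² |∂ᵢG|² / (2 aᵢ)` as `t → 0`. -/
noncomputable def supConv {n : ℕ} (a : Fin n → ℝ) (G : (Fin n → ℝ) → ℝ) (t : ℝ)
    (z : Fin n → ℝ) : ℝ :=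
  ⨆ e, quotientSubQuadratic a G t z e

section supConv

variable {n : ℕ} {a : Fin n → ℝ} {G : (Fin n → ℝ) → ℝ} {L : NNReal}

theorem mul_sub_sq_le {s p x : ℝ} (hs : 0 < s) : p * x - s / 2 * x ^ 2 ≤ p ^ 2 / (2 * s) := by
  rw [le_div_iff₀ (by positivity)]
  nlinarith [sq_nonneg (p - s * x)]

theorem norm_le_sum_abs (v : Fin n → ℝ) : ‖v‖ ≤ ∑ i, |v i| :=
  (pi_norm_le_iff_of_nonneg (Finset.sum_nonneg fun _ _ => abs_nonneg _)).2 fun i =>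
    Finset.single_le_sum (f := fun i => |v i|) (fun _ _ => abs_nonneg _) (Finset.mem_univ i)

theorem quotient_le (hG : LipschitzWith L G) {t : ℝ} (ht : 0 < t) (z e : Fin n → ℝ) :
    (G (z + t • (z * e)) - G (z - t • (z * e))) / (2 * t) ≤ ∑ i, L * |z i| * |e i| := by
  rw [div_le_iff₀ (by positivity)]
  have h1 := (le_abs_self _).trans (hG.dist_le_mul (z + t • (z * e)) (z - t • (z * e)))
  rw [dist_eq_norm] at h1
  have h2 : z + t • (z * e) - (z - t • (z * e)) = (2 * t) • (z * e) := by
    rw [two_mul, add_smul]; abel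
  rw [h2, norm_smul, Real.norm_of_nonneg (by positivity)] at h1
  have h3 := norm_le_sum_abs (z * e)
  calc _ ≤ (L : ℝ) * (2 * t * ‖z * e‖) := h1
    _ ≤ (L : ℝ) * (2 * t * ∑ i, |(z * e) i|) := by gcongr
    _ = _ := by
      rw [Finset.sum_mul, Finset.mul_sum, Finset.mul_sum]
      refine Finset.sum_congr rfl fun i _ => ?_
      rw [Pi.mul_apply, abs_mul]
      ring

theorem quotientSubQuadratic_le (ha : ∀ i, 0 < a i) (hG : LipschitzWith L G) {t : ℝ} (ht : 0 < t)
    (z e : Fin n → ℝ) :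
    quotientSubQuadratic a G t z e ≤ ∑ i, (L * |z i|) ^ 2 / (2 * a i) := by
  have h := quotient_le hG ht z e
  calc quotientSubQuadratic a G t z e
      ≤ ∑ i, L * |z i| * |e i| - ∑ i, a i / 2 * e i ^ 2 := by
        unfold quotientSubQuadratic; linarith
    _ ≤ _ := by
        rw [← Finset.sum_sub_distrib]
        refine Finset.sum_le_sum fun i _ => ?_
        rw [← sq_abs (e i)]
        exact mul_sub_sq_le (ha i)

theorem bddAbove_quotientSubQuadratic (ha : ∀ i, 0 < a i) (hG : LipschitzWith L G) {t : ℝ}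
    (ht : 0 < t) (z : Fin n → ℝ) : BddAbove (Set.range fun e => quotientSubQuadratic a G t z e) :=
  ⟨_, by rintro _ ⟨e, rfl⟩; exact quotientSubQuadratic_le ha hG ht z e⟩

theorem quotientSubQuadratic_le_supConv (ha : ∀ i, 0 < a i) (hG : LipschitzWith L G) {t : ℝ}
    (ht : 0 < t) (z e : Fin n → ℝ) : quotientSubQuadratic a G t z e ≤ supConv a G t z :=
  le_ciSup (bddAbove_quotientSubQuadratic ha hG ht z) e

theorem supConv_nonneg (ha : ∀ i, 0 < a i) (hG : LipschitzWith L G) {t : ℝ} (ht : 0 < t)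
    (z : Fin n → ℝ) : 0 ≤ supConv a G t z := by
  refine le_trans (le_of_eq ?_) (quotientSubQuadratic_le_supConv ha hG ht z 0)
  simp [quotientSubQuadratic]

theorem supConv_le (ha : ∀ i, 0 < a i) (hG : LipschitzWith L G) {t : ℝ} (ht : 0 < t)
    (z : Fin n → ℝ) : supConv a G t z ≤ ∑ i, (L * |z i|) ^ 2 / (2 * a i) :=
  ciSup_le fun e => quotientSubQuadratic_le ha hG ht z e

/-- The supremum is over an uncountable family, but of continuous functions, hence lower
semicontinuous. -/
theorem measurable_supConv (ha : ∀ i, 0 < a i) (hG : LipschitzWith L G) {t : ℝ} (ht : 0 < t) :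
    Measurable (supConv a G t) := by
  refine LowerSemicontinuous.measurable (lowerSemicontinuous_ciSup
    (bddAbove_quotientSubQuadratic ha hG ht) fun e => Continuous.lowerSemicontinuous ?_)
  have := hG.continuous
  unfold quotientSubQuadratic
  fun_prop

/-- For small displacements the difference quotient is nearly linear in `e`, and completing the
square gives the Legendre transform. For large ones the quadratic penalty outweighs the linear
growth allowed by the Lipschitz bound, so the value is at most 0. -/
theorem eventually_supConv_le (ha : ∀ i, 0 < a i) (hG : LipschitzWith L G) {z : Fin n → ℝ}
    (hz : DifferentiableAt ℝ G z) {ε : ℝ} (hε : 0 < ε) :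
    ∀ᶠ t in nhdsWithin 0 (Set.Ioi 0), supConv a G t z
      ≤ ∑ i, (|lineDeriv ℝ G z (Pi.single i 1)| * |z i|) ^ 2 / (2 * a i) + ε := by
  set p : Fin n → ℝ := fun i => lineDeriv ℝ G z (Pi.single i 1)
  have hpe : ∀ i, p i = lineDeriv ℝ G z (Pi.single i 1) := fun _ => rfl
  obtain ⟨δ, hδ, hδε⟩ : ∃ δ > 0, ∑ i, ((|p i| + δ) * |z i|) ^ 2 / (2 * a i)
      ≤ ∑ i, (|p i| * |z i|) ^ 2 / (2 * a i) + ε := by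
    have hc : Continuous fun δ : ℝ => ∑ i, ((|p i| + δ) * |z i|) ^ 2 / (2 * a i) := by fun_prop
    have h1 := ((hc.tendsto 0).mono_left (nhdsWithin_le_nhds (s := Set.Ioi 0))).eventually_lt_const
      (u := ∑ i, (|p i| * |z i|) ^ 2 / (2 * a i) + ε) (by simpa using hε)
    obtain ⟨δ, h2, h3⟩ := (h1.and self_mem_nhdsWithin).exists
    exact ⟨δ, h3, h2.le⟩
  have hd := hz.hasFDerivAt.isLittleO.def hδ
  rw [Metric.eventually_nhds_iff] at hd
  obtain ⟨η, hη, hd⟩ := hd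
  have hid : Filter.Tendsto (fun t : ℝ => t) (nhdsWithin 0 (Set.Ioi 0)) (nhds 0) :=
    Filter.tendsto_id.mono_left nhdsWithin_le_nhds
  -- `C` bounds `∑ (L |z_j| |e_j| - a_j / 4 e_j ^ 2)`: half of the penalty absorbs the linear term
  -- up to `C`, and for small `t` the other half exceeds `C` once the displacement reaches `η`.
  set C := ∑ j, (L * |z j|) ^ 2 / a j
  have hC : 0 ≤ C := Finset.sum_nonneg fun j _ => by have := ha j; positivity
  have hsmall : ∀ᶠ t : ℝ in nhdsWithin 0 (Set.Ioi 0),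
      ∀ i, t ^ 2 * (|z i| ^ 2 * C) < a i / 4 * η ^ 2 := by
    rw [Filter.eventually_all]
    intro i
    refine Filter.Tendsto.eventually_lt_const (v := 0 ^ 2 * (|z i| ^ 2 * C)) ?_
      ((hid.pow 2).mul_const _)
    have := ha i
    simp only [ne_eq, OfNat.ofNat_ne_zero, not_false_eq_true, zero_pow, zero_mul]
    positivity
  filter_upwards [hsmall, self_mem_nhdsWithin] with t hts ht
  have ht : 0 < t := ht
  refine ciSup_le fun e => ?_
  by_cases he : ‖t • (z * e)‖ < η
  · refine le_trans ?_ hδε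
    have d1 := hd (y := z + t • (z * e)) (by simpa [dist_eq_norm] using he)
    have d2 := hd (y := z - t • (z * e)) (by simpa [dist_eq_norm] using he)
    simp only [add_sub_cancel_left, sub_sub_cancel_left, map_neg, norm_neg,
      Real.norm_eq_abs] at d1 d2
    have d1' := (abs_le.1 d1).2
    have d2' := (abs_le.1 d2).1
    have hlin : fderiv ℝ G z (t • (z * e)) = t * ∑ i, p i * (z i * e i) := by
      rw [map_smul, smul_eq_mul]
      congr 1
      conv_lhs => rw [pi_eq_sum_univ' (z * e)]
      rw [map_sum]
      refine Finset.sum_congr rfl fun i _ => ?_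
      rw [map_smul, smul_eq_mul, hpe, hz.lineDeriv_eq_fderiv, Pi.mul_apply, mul_comm]
    have hn := norm_le_sum_abs (z * e)
    rw [norm_smul, Real.norm_of_nonneg ht.le] at d1' d2'
    rw [hlin] at d1' d2'
    have hquot : (G (z + t • (z * e)) - G (z - t • (z * e))) / (2 * t)
        ≤ ∑ i, p i * (z i * e i) + δ * ∑ i, |(z * e) i| := by
      rw [div_le_iff₀ (by positivity)]
      have : δ * (t * ‖z * e‖) ≤ δ * (t * ∑ i, |(z * e) i|) := by gcongr
      linarith
    calc quotientSubQuadratic a G t z e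
        ≤ ∑ i, p i * (z i * e i) + δ * ∑ i, |(z * e) i| - ∑ i, a i / 2 * e i ^ 2 := by
          unfold quotientSubQuadratic; linarith
      _ ≤ _ := by
          rw [Finset.mul_sum, ← Finset.sum_add_distrib, ← Finset.sum_sub_distrib]
          refine Finset.sum_le_sum fun i _ => ?_
          refine le_trans ?_ (mul_sub_sq_le (ha i) (x := |e i|))
          rw [sq_abs, Pi.mul_apply, abs_mul]
          have : p i * (z i * e i) ≤ |p i| * (|z i| * |e i|) := by
            rw [← abs_mul, ← abs_mul]; exact le_abs_self _
          linarith
  · obtain ⟨i, hi⟩ : ∃ i, η ≤ |t * (z i * e i)| := by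
      by_contra hcon
      push Not at hcon
      exact he ((pi_norm_lt_iff hη).2 hcon)
    have hq := quotient_le hG ht z e
    have hCe : C ≤ ∑ j, a j / 4 * e j ^ 2 := by
      refine le_trans ?_ (Finset.single_le_sum (f := fun j => a j / 4 * e j ^ 2)
        (fun j _ => by have := ha j; positivity) (Finset.mem_univ i))
      have hai := ha i
      have h1 : η ^ 2 ≤ t ^ 2 * |z i| ^ 2 * e i ^ 2 := by
        have := pow_le_pow_left₀ hη.le hi 2
        rw [sq_abs] at this
        rw [sq_abs]
        linarith
      have hpos : 0 < t ^ 2 * |z i| ^ 2 := by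
        by_contra hcon
        have h0 : t ^ 2 * |z i| ^ 2 = 0 := le_antisymm (not_lt.1 hcon) (by positivity)
        rw [h0, zero_mul] at h1
        nlinarith
      refine le_of_mul_le_mul_left ?_ hpos
      have := hts i
      have h2 : a i / 4 * η ^ 2 ≤ a i / 4 * (t ^ 2 * |z i| ^ 2 * e i ^ 2) := by gcongr
      linarith
    have hS : 0 ≤ ∑ i, (|p i| * |z i|) ^ 2 / (2 * a i) :=
      Finset.sum_nonneg fun j _ => by have := ha j; positivity
    have hb : ∑ i, L * |z i| * |e i| - ∑ i, a i / 4 * e i ^ 2 ≤ C := by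
      rw [← Finset.sum_sub_distrib]
      refine Finset.sum_le_sum fun j _ => ?_
      have := mul_sub_sq_le (s := a j / 2) (p := L * |z j|) (x := |e j|)
        (by have := ha j; positivity)
      rw [sq_abs] at this
      refine le_trans (le_of_eq (by ring)) (this.trans (le_of_eq ?_))
      congr 1
      ring
    have hsplit : ∑ j, a j / 2 * e j ^ 2 = ∑ j, a j / 4 * e j ^ 2 + ∑ j, a j / 4 * e j ^ 2 := by
      rw [← Finset.sum_add_distrib]
      refine Finset.sum_congr rfl fun j _ => by ring
    unfold quotientSubQuadratic
    linarith

end supConv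

/-! ### The Brascamp-Lieb inequality on a bounded convex set. -/

theorem prekopaLeindler_withDensity {n : ℕ} {a : Fin n → ℝ} {G W : (Fin n → ℝ) → ℝ} {L : NNReal}
    (ha : ∀ i, 0 < a i) (hG : LipschitzWith L G) {B : Set (Fin n → ℝ)} (hB : MeasurableSet B)
    (hBpos : B ⊆ posOrthant n) (hBconv : Convex ℝ B) (hW : Measurable W)
    (hmid : ∀ x ∈ B, ∀ y ∈ B, 2 * W ((1 / 2 : ℝ) • (x + y))
      + ∑ i, a i * ((x i - y i) / (x i + y i)) ^ 2 ≤ W x + W y) {t : ℝ} (ht : 0 < t) :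
    (∫⁻ x, ENNReal.ofReal (Real.exp (t * G x))
        ∂(volume.restrict B).withDensity fun x => ENNReal.ofReal (Real.exp (-W x))) *
      (∫⁻ x, ENNReal.ofReal (Real.exp (-t * G x))
        ∂(volume.restrict B).withDensity fun x => ENNReal.ofReal (Real.exp (-W x))) ≤
      (∫⁻ x, ENNReal.ofReal (Real.exp (t ^ 2 * supConv a G t x))
        ∂(volume.restrict B).withDensity fun x => ENNReal.ofReal (Real.exp (-W x))) ^ 2 := by
  have hGm := hG.continuous.measurable
  have hs := measurable_supConv ha hG ht
  have conv : ∀ F : (Fin n → ℝ) → ℝ, Measurable F →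
      ∫⁻ x, ENNReal.ofReal (Real.exp (F x))
        ∂(volume.restrict B).withDensity (fun x => ENNReal.ofReal (Real.exp (-W x)))
      = ∫⁻ x, B.indicator (fun x => ENNReal.ofReal (Real.exp (-W x + F x))) x := by
    intro F hF
    rw [lintegral_withDensity_eq_lintegral_mul _ (by fun_prop) (by fun_prop),
      lintegral_indicator hB]
    simp only [Pi.mul_apply, Real.exp_add, ENNReal.ofReal_mul (Real.exp_pos _).le]
  rw [conv _ (by fun_prop), conv _ (by fun_prop), conv _ (by fun_prop)]
  refine prekopaLeindler (Measurable.indicator (by fun_prop) hB)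
    (Measurable.indicator (by fun_prop) hB) (Measurable.indicator (by fun_prop) hB) fun x y => ?_
  by_cases hx : x ∈ B
  swap
  · simp [hx]
  by_cases hy : y ∈ B
  swap
  · simp [hy]
  have hz : (1 / 2 : ℝ) • (x + y) ∈ B := by
    rw [smul_add]
    exact hBconv hx hy (by norm_num) (by norm_num) (by norm_num)
  rw [Set.indicator_of_mem hx, Set.indicator_of_mem hy, Set.indicator_of_mem hz,
    ← ENNReal.ofReal_mul (Real.exp_pos _).le, ← Real.exp_add,
    ← ENNReal.ofReal_pow (Real.exp_pos _).le, ← Real.exp_nat_mul]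
  refine ENNReal.ofReal_le_ofReal (Real.exp_le_exp.2 ?_)
  set z := (1 / 2 : ℝ) • (x + y)
  have hsum : ∀ i, 0 < x i + y i := fun i => add_pos (hBpos hx i) (hBpos hy i)
  -- This `e` makes `x` and `y` equal to `z ± t z e`. The penalty times `2 t ^ 2` is then exactly
  -- the convexity gain in `hmid`.
  let e : Fin n → ℝ := fun i => (x i - y i) / (t * (x i + y i))
  have hze : t • (z * e) = (1 / 2 : ℝ) • (x - y) := by
    ext i
    have := (hsum i).ne'
    simp only [z, e, Pi.smul_apply, Pi.mul_apply, Pi.add_apply, Pi.sub_apply, smul_eq_mul]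
    field_simp
  have h1 : z + t • (z * e) = x := by
    rw [hze, ← smul_add]; ext i; simp; ring
  have h2 : z - t • (z * e) = y := by
    rw [hze, ← smul_sub]; ext i; simp; ring
  have hq := quotientSubQuadratic_le_supConv ha hG ht z e
  unfold quotientSubQuadratic at hq
  rw [h1, h2] at hq
  have h3 : 2 * t ^ 2 * ((G x - G y) / (2 * t) - ∑ i, a i / 2 * e i ^ 2)
      = t * (G x - G y) - ∑ i, a i * ((x i - y i) / (x i + y i)) ^ 2 := by
    rw [mul_sub, Finset.mul_sum]
    congr 1
    · field_simp
    · refine Finset.sum_congr rfl fun i _ => ?_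
      have := (hsum i).ne'
      simp only [e]
      field_simp
  have h4 := mul_le_mul_of_nonneg_left hq (by positivity : 0 ≤ 2 * t ^ 2)
  have h5 := hmid x hx y hy
  push_cast
  linarith

/-- The Brascamp-Lieb inequality on a box in the orthant, for a Lipschitz function. -/
theorem brascampLieb_of_lipschitzWith {n : ℕ} {a : Fin n → ℝ} {G W : (Fin n → ℝ) → ℝ}
    {L : NNReal} (ha : ∀ i, 0 < a i) (hG : LipschitzWith L G) {B : Set (Fin n → ℝ)}
    (hB : MeasurableSet B) (hBpos : B ⊆ posOrthant n) (hBconv : Convex ℝ B)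
    (hBbdd : Bornology.IsBounded B) (hW : Measurable W) {C : ℝ} (hWC : ∀ x ∈ B, C ≤ W x)
    (hmid : ∀ x ∈ B, ∀ y ∈ B, 2 * W ((1 / 2 : ℝ) • (x + y))
      + ∑ i, a i * ((x i - y i) / (x i + y i)) ^ 2 ≤ W x + W y)
    {ν : Measure (Fin n → ℝ)}
    (hν : ν = (volume.restrict B).withDensity fun x => ENNReal.ofReal (Real.exp (-W x))) :
    ∫⁻ x, ENNReal.ofReal (G x ^ 2) ∂ν ≤ ENNReal.ofReal ((∫ x, G x ∂ν) ^ 2) / ν Set.univ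
      + ∫⁻ x, ENNReal.ofReal (∑ i, x i ^ 2 / a i * |partialD i G x| ^ 2) ∂ν := by
  have hac : ν ≪ volume.restrict B := hν ▸ withDensity_absolutelyContinuous _ _
  have haeB : ∀ᵐ x ∂ν, x ∈ B := hac.ae_le (ae_restrict_mem hB)
  obtain ⟨R, hR⟩ := hBbdd.exists_norm_le
  have hfin : IsFiniteMeasure ν := by
    refine ⟨?_⟩
    rw [hν, withDensity_apply _ MeasurableSet.univ, Measure.restrict_univ]
    calc _ ≤ ∫⁻ _ in B, ENNReal.ofReal (Real.exp (-C)) := by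
          refine setLIntegral_mono measurable_const fun x hx => ?_
          exact ENNReal.ofReal_le_ofReal (Real.exp_le_exp.2 (neg_le_neg (hWC x hx)))
      _ < ⊤ := by
          rw [setLIntegral_const]
          exact ENNReal.mul_lt_top ENNReal.ofReal_lt_top hBbdd.measure_lt_top
  have hGm := hG.continuous.measurable
  have hGbdd : ∀ x ∈ B, |G x| ≤ |G 0| + L * R := by
    intro x hx
    have h1 := hG.dist_le_mul x 0
    rw [dist_zero_right, Real.dist_eq] at h1
    have h2 : (L : ℝ) * ‖x‖ ≤ L * R := mul_le_mul_of_nonneg_left (hR x hx) L.2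
    have h3 := abs_sub_abs_le_abs_sub (G x) (G 0)
    linarith
  have hD : ∀ i x, |partialD i G x| ≤ L := by
    intro i x
    have := norm_lineDeriv_le_of_lipschitz ℝ hG (x₀ := x) (v := Pi.single i 1)
    simpa [partialD, Pi.norm_single] using this
  have hDm : ∀ i, Measurable (partialD i G) := fun i => measurable_lineDeriv hG.continuous
  have hcoord : ∀ x ∈ B, ∀ i, |x i| ≤ R := fun x hx i => (norm_le_pi_norm x i).trans (hR x hx)
  let q : (Fin n → ℝ) → ℝ := fun x => ∑ i, (|partialD i G x| * |x i|) ^ 2 / (2 * a i)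
  set K : ℝ := ∑ i, (L * R) ^ 2 / (2 * a i)
  have hKle : ∀ x ∈ B, ∑ i, (L * |x i|) ^ 2 / (2 * a i) ≤ K := by
    intro x hx
    refine Finset.sum_le_sum fun i _ => ?_
    have := hcoord x hx i
    have := ha i
    gcongr
  have hqm : Measurable q := by fun_prop
  have hbounds : ∀ t > 0, ∀ᵐ x ∂ν, supConv a G t x ≤ K := fun t ht => by
    filter_upwards [haeB] with x hx
    exact (supConv_le ha hG ht x).trans (hKle x hx)
  have key := measure_mul_integral_sq_le (ν := ν) (g := G) (q := q) (r := supConv a G) (K := K)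
    hGm.aestronglyMeasurable (by filter_upwards [haeB] with x hx using hGbdd x hx)
    hqm.aestronglyMeasurable
    (Filter.Eventually.of_forall fun x => Finset.sum_nonneg fun i _ => by
      have := ha i; positivity)
    (by
      filter_upwards [haeB] with x hx
      refine le_trans (Finset.sum_le_sum fun i _ => ?_) (hKle x hx)
      have := hD i x
      have := ha i
      gcongr)
    (fun t ht => (measurable_supConv ha hG ht).aestronglyMeasurable)
    (fun t ht => Filter.Eventually.of_forall fun x => supConv_nonneg ha hG ht x)
    hbounds
    (by
      filter_upwards [(hac.trans Measure.restrict_le_self.absolutelyContinuous).ae_le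
        hG.ae_differentiableAt] with x hx ε hε using eventually_supConv_le ha hG hx hε)
    (fun t ht => by
      have hPL := prekopaLeindler_withDensity ha hG hB hBpos hBconv hW hmid ht
      rw [← hν] at hPL
      have hs := measurable_supConv ha hG ht
      have hint : ∀ F : (Fin n → ℝ) → ℝ, Measurable F → (∃ c, ∀ᵐ x ∂ν, F x ≤ c) →
          ∫⁻ x, ENNReal.ofReal (Real.exp (F x)) ∂ν
            = ENNReal.ofReal (∫ x, Real.exp (F x) ∂ν) := by
        rintro F hF ⟨c, hc⟩
        refine (ofReal_integral_eq_lintegral_ofReal ?_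
          (Filter.Eventually.of_forall fun x => (Real.exp_pos _).le)).symm
        refine Integrable.of_bound (by fun_prop) (Real.exp c) ?_
        filter_upwards [hc] with x hx
        rw [Real.norm_eq_abs, Real.abs_exp]
        exact Real.exp_le_exp.2 hx
      have hlin : ∀ s : ℝ, ∃ c, ∀ᵐ x ∂ν, s * G x ≤ c := fun s => ⟨|s| * (|G 0| + L * R), by
        filter_upwards [haeB] with x hx
        refine (le_abs_self _).trans ?_
        rw [abs_mul]
        exact mul_le_mul_of_nonneg_left (hGbdd x hx) (abs_nonneg s)⟩
      rw [hint _ (by fun_prop) (hlin t), hint _ (by fun_prop) (hlin (-t)),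
        hint _ (by fun_prop) ⟨t ^ 2 * K, by
          filter_upwards [hbounds t ht] with x hx
          exact mul_le_mul_of_nonneg_left hx (by positivity)⟩,
        ← ENNReal.ofReal_mul (integral_nonneg fun x => (Real.exp_pos _).le),
        ← ENNReal.ofReal_pow (integral_nonneg fun x => (Real.exp_pos _).le)] at hPL
      exact (ENNReal.ofReal_le_ofReal_iff (by positivity)).1 hPL)
  rcases eq_or_ne (ν Set.univ) 0 with h0 | h0
  · rw [Measure.measure_univ_eq_zero.1 h0]
    simp
  have hM : 0 < ν.real Set.univ := ENNReal.toReal_pos h0 (measure_ne_top ν _)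
  have hq2 : 2 * ∫ x, q x ∂ν = ∫ x, ∑ i, x i ^ 2 / a i * |partialD i G x| ^ 2 ∂ν := by
    rw [← integral_const_mul]
    refine integral_congr_ae (Filter.Eventually.of_forall fun x => ?_)
    simp only [q]
    rw [Finset.mul_sum]
    refine Finset.sum_congr rfl fun i _ => ?_
    have := (ha i).ne'
    rw [mul_pow, sq_abs, sq_abs]
    field_simp
  have hG2 : Integrable (fun x => G x ^ 2) ν := by
    refine Integrable.of_bound (by fun_prop) ((|G 0| + L * R) ^ 2) ?_
    filter_upwards [haeB] with x hx
    rw [Real.norm_eq_abs, abs_pow]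
    exact pow_le_pow_left₀ (abs_nonneg _) (hGbdd x hx) 2
  have hS : ∫ x, G x ^ 2 ∂ν ≤ (∫ x, G x ∂ν) ^ 2 / ν.real Set.univ + 2 * ∫ x, q x ∂ν := by
    rw [← sub_le_iff_le_add, le_div_iff₀ hM]
    linarith
  rw [← ofReal_integral_eq_lintegral_ofReal hG2 (Filter.Eventually.of_forall fun x => sq_nonneg _)]
  refine (ENNReal.ofReal_le_ofReal hS).trans (ENNReal.ofReal_add_le.trans ?_)
  refine add_le_add (le_of_eq ?_) ?_
  · rw [ENNReal.ofReal_div_of_pos hM, Measure.real, ENNReal.ofReal_toReal (measure_ne_top ν _)]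
  · rw [hq2, integral_eq_lintegral_of_nonneg_ae (Filter.Eventually.of_forall fun x =>
      Finset.sum_nonneg fun i _ => by have := ha i; positivity)
      (Measurable.aestronglyMeasurable (by fun_prop))]
    exact ENNReal.ofReal_toReal_le

/-! ### Exhaustion by boxes and passage to the whole orthant. -/

/-- An exhaustion of the open orthant by open boxes. -/
def orthantBox (n m : ℕ) : Set (Fin n → ℝ) :=
  Set.univ.pi fun _ => Set.Ioo (1 / ((m : ℝ) + 2)) (m + 2)

section orthantBox

variable {n : ℕ}

theorem isOpen_orthantBox (m : ℕ) : IsOpen (orthantBox n m) :=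
  isOpen_set_pi Set.finite_univ fun _ _ => isOpen_Ioo

theorem orthantBox_subset_Icc (m : ℕ) :
    orthantBox n m ⊆ Set.Icc (fun _ => 1 / ((m : ℝ) + 2)) (fun _ => (m : ℝ) + 2) :=
  fun _ hx => ⟨fun i => (hx i trivial).1.le, fun i => (hx i trivial).2.le⟩

theorem Icc_subset_posOrthant (m : ℕ) :
    Set.Icc (fun _ => 1 / ((m : ℝ) + 2)) (fun _ => (m : ℝ) + 2) ⊆ posOrthant n :=
  fun _ hx i => lt_of_lt_of_le (by positivity) (hx.1 i)

theorem orthantBox_subset_posOrthant (m : ℕ) : orthantBox n m ⊆ posOrthant n :=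
  (orthantBox_subset_Icc m).trans (Icc_subset_posOrthant m)

theorem convex_orthantBox (m : ℕ) : Convex ℝ (orthantBox n m) :=
  convex_pi fun _ _ => convex_Ioo _ _

theorem monotone_orthantBox : Monotone (orthantBox n) := by
  intro m m' h x hx i _
  have h' : (m : ℝ) ≤ m' := by exact_mod_cast h
  refine ⟨lt_of_le_of_lt ?_ (hx i trivial).1, lt_of_lt_of_le (hx i trivial).2 (by linarith)⟩
  exact one_div_le_one_div_of_le (by positivity) (by linarith)

theorem iUnion_orthantBox : ⋃ m, orthantBox n m = posOrthant n := by
  refine Set.Subset.antisymm (Set.iUnion_subset orthantBox_subset_posOrthant) fun x hx => ?_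
  obtain ⟨m, hm⟩ : ∃ m : ℕ, ∀ i, max (x i) (1 / x i) < m := by
    obtain ⟨c, hc⟩ := (Set.finite_range fun i => max (x i) (1 / x i)).bddAbove
    obtain ⟨m, hm⟩ := exists_nat_gt c
    exact ⟨m, fun i => lt_of_le_of_lt (hc ⟨i, rfl⟩) hm⟩
  refine Set.mem_iUnion.2 ⟨m, fun i _ => ⟨?_, ?_⟩⟩
  · rw [one_div_lt (by positivity) (hx i)]
    linarith [le_max_right (x i) (1 / x i), hm i]
  · linarith [le_max_left (x i) (1 / x i), hm i]

theorem volume_orthantBox_ne_zero (m : ℕ) : volume (orthantBox n m) ≠ 0 := by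
  refine ((isOpen_orthantBox m).measure_pos volume ⟨fun _ => 1, fun i _ => ⟨?_, ?_⟩⟩).ne'
  · rw [div_lt_one (by positivity)]
    linarith [Nat.cast_nonneg (α := ℝ) m]
  · linarith [Nat.cast_nonneg (α := ℝ) m]

theorem isOpen_posOrthant : IsOpen (posOrthant n) := by
  rw [← iUnion_orthantBox]
  exact isOpen_iUnion isOpen_orthantBox

end orthantBox

theorem ae_differentiableAt_of_locallyLipschitzOn {n : ℕ} {f : (Fin n → ℝ) → ℝ}
    (hf : LocallyLipschitzOn (posOrthant n) f) :
    ∀ᵐ x, x ∈ posOrthant n → DifferentiableAt ℝ f x := by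
  have h : ∀ m : ℕ, ∀ᵐ x, x ∈ orthantBox n m → DifferentiableAt ℝ f x := by
    intro m
    obtain ⟨L, hL⟩ := (hf.mono (Icc_subset_posOrthant m)).exists_lipschitzOnWith_of_compact
      isCompact_Icc
    filter_upwards [(hL.mono (orthantBox_subset_Icc m)).ae_differentiableWithinAt_of_mem] with x hx
    intro hxB
    exact (hx hxB).differentiableAt ((isOpen_orthantBox m).mem_nhds hxB)
  filter_upwards [ae_all_iff.2 h] with x hx hxO
  rw [← iUnion_orthantBox] at hxO
  obtain ⟨m, hm⟩ := Set.mem_iUnion.1 hxO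
  exact hx m hm

/-- The Brascamp-Lieb inequality on an orthant box, for a locally Lipschitz function. -/
theorem brascampLieb_orthantBox {n : ℕ} {a : Fin n → ℝ} {g W : (Fin n → ℝ) → ℝ}
    (ha : ∀ i, 0 < a i) (hg : LocallyLipschitzOn (posOrthant n) g)
    (hW : ContinuousOn W (posOrthant n))
    (hmid : ∀ x ∈ posOrthant n, ∀ y ∈ posOrthant n, 2 * W ((1 / 2 : ℝ) • (x + y))
      + ∑ i, a i * ((x i - y i) / (x i + y i)) ^ 2 ≤ W x + W y) (m : ℕ) :
    ∫⁻ x in orthantBox n m, ENNReal.ofReal (g x ^ 2) ∂(orthantMeasure W) ≤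
      ENNReal.ofReal ((∫ x in orthantBox n m, g x ∂(orthantMeasure W)) ^ 2)
        / orthantMeasure W (orthantBox n m)
      + ∫⁻ x in orthantBox n m, ENNReal.ofReal (∑ i, x i ^ 2 / a i * |partialD i g x| ^ 2)
          ∂(orthantMeasure W) := by
  classical
  set B := orthantBox n m
  have hBo : IsOpen B := isOpen_orthantBox m
  have hB : MeasurableSet B := hBo.measurableSet
  have hBpos : B ⊆ posOrthant n := orthantBox_subset_posOrthant m
  obtain ⟨L, hL⟩ := (hg.mono (Icc_subset_posOrthant m)).exists_lipschitzOnWith_of_compact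
      isCompact_Icc
  -- A global Lipschitz extension is harmless: the box is open, so `g` and `G` have the same partial
  -- derivatives on it.
  obtain ⟨G, hG, hgG⟩ := (hL.mono (orthantBox_subset_Icc m)).extend_real
  obtain ⟨C, hC⟩ := (isCompact_Icc.bddBelow_image (hW.mono (Icc_subset_posOrthant m)))
  let W' : (Fin n → ℝ) → ℝ := B.piecewise W 0
  have hW' : ∀ x ∈ B, W' x = W x := fun x hx => Set.piecewise_eq_of_mem _ _ _ hx
  have hν : (orthantMeasure W).restrict B
      = (volume.restrict B).withDensity fun x => ENNReal.ofReal (Real.exp (-W' x)) := by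
    rw [orthantMeasure, restrict_withDensity hB, Measure.restrict_restrict hB,
      Set.inter_eq_left.2 hBpos]
    refine withDensity_congr_ae ?_
    filter_upwards [ae_restrict_mem hB] with x hx
    rw [hW' x hx]
  have key := brascampLieb_of_lipschitzWith ha hG hB hBpos (convex_orthantBox m)
    ((Metric.isBounded_Icc _ _).subset (orthantBox_subset_Icc m)) (W := W') (C := C)
    (ContinuousOn.measurable_piecewise (hW.mono hBpos) continuousOn_const hB)
    (fun x hx => by
      rw [hW' x hx]
      exact hC ⟨x, orthantBox_subset_Icc m hx, rfl⟩)
    (fun x hx y hy => by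
      have hz : (1 / 2 : ℝ) • (x + y) ∈ B := by
        rw [smul_add]
        exact convex_orthantBox m hx hy (by norm_num) (by norm_num) (by norm_num)
      rw [hW' x hx, hW' y hy, hW' _ hz]
      exact hmid x (hBpos hx) y (hBpos hy)) hν
  rw [Measure.restrict_apply_univ] at key
  rw [setLIntegral_congr_fun hB fun x hx => by rw [hgG hx],
    setIntegral_congr_fun hB fun x hx => hgG hx]
  refine key.trans (add_le_add le_rfl (le_of_eq ?_))
  refine setLIntegral_congr_fun hB fun x hx => ?_
  have hD : ∀ i, partialD i g x = partialD i G x := fun i =>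
    Filter.EventuallyEq.lineDeriv_eq (hgG.eventuallyEq_of_mem (hBo.mem_nhds hx))
  simp only [hD]

/-- The Brascamp-Lieb inequality on the orthant for the measure with density `exp (-W)`, where the
Hessian of `W` is bounded below by the diagonal matrix with entries `aᵢ / xᵢ²`. -/
theorem brascampLieb_orthant {n : ℕ} {a : Fin n → ℝ} {g W : (Fin n → ℝ) → ℝ}
    (ha : ∀ i, 0 < a i) (hg : LocallyLipschitzOn (posOrthant n) g)
    (hW : ContinuousOn W (posOrthant n))
    (hmid : ∀ x ∈ posOrthant n, ∀ y ∈ posOrthant n, 2 * W ((1 / 2 : ℝ) • (x + y))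
      + ∑ i, a i * ((x i - y i) / (x i + y i)) ^ 2 ≤ W x + W y)
    (hint : Integrable g (orthantMeasure W)) (hmean : ∫ x, g x ∂(orthantMeasure W) = 0) :
    ∫⁻ x, ENNReal.ofReal (g x ^ 2) ∂(orthantMeasure W) ≤
      ∫⁻ x, ENNReal.ofReal (∑ i, x i ^ 2 / a i * |partialD i g x| ^ 2) ∂(orthantMeasure W) := by
  set μ := orthantMeasure W with hμ
  have hO : MeasurableSet (posOrthant n) := isOpen_posOrthant.measurableSet
  have hrestr : μ.restrict (⋃ m, orthantBox n m) = μ := by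
    rw [iUnion_orthantBox, hμ, orthantMeasure, restrict_withDensity hO,
      Measure.restrict_restrict hO, Set.inter_self]
  have hBm : ∀ m, MeasurableSet (orthantBox n m) := fun m => (isOpen_orthantBox m).measurableSet
  have hμ0 : μ (orthantBox n 0) ≠ 0 := by
    intro h0
    rw [hμ, orthantMeasure, withDensity_apply _ (hBm 0), Measure.restrict_restrict (hBm 0),
      Set.inter_eq_left.2 (orthantBox_subset_posOrthant 0)] at h0
    have hc : ContinuousOn (fun x => ENNReal.ofReal (Real.exp (-W x))) (orthantBox n 0) :=
      ENNReal.continuous_ofReal.comp_continuousOn (Real.continuous_exp.comp_continuousOn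
        (hW.mono (orthantBox_subset_posOrthant 0)).neg)
    rw [lintegral_eq_zero_iff' (hc.aemeasurable (hBm 0))] at h0
    refine volume_orthantBox_ne_zero (n := n) 0 ?_
    have hF : ∀ᵐ _ ∂volume.restrict (orthantBox n 0), False := by
      filter_upwards [h0] with x hx
      simp only [Pi.zero_apply, ENNReal.ofReal_eq_zero] at hx
      exact absurd hx (not_le.2 (Real.exp_pos _))
    simpa [ae_iff] using hF
  have hleft : Filter.Tendsto
      (fun m => ∫⁻ x in orthantBox n m, ENNReal.ofReal (g x ^ 2) ∂μ) Filter.atTop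
      (nhds (∫⁻ x, ENNReal.ofReal (g x ^ 2) ∂μ)) := by
    have h := setLIntegral_iUnion_of_directed (μ := μ) (fun x => ENNReal.ofReal (g x ^ 2))
      (monotone_orthantBox (n := n)).directed_le
    rw [hrestr] at h
    rw [h]
    exact tendsto_atTop_iSup fun m m' hm => lintegral_mono_set (monotone_orthantBox hm)
  have hmeanlim : Filter.Tendsto (fun m => ∫ x in orthantBox n m, g x ∂μ) Filter.atTop
      (nhds 0) := by
    have h := tendsto_setIntegral_of_monotone hBm monotone_orthantBox (f := g) (μ := μ)
      hint.integrableOn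
    rwa [hrestr, hmean] at h
  -- The squared mean is divided by the fixed positive mass of box 0, which bounds the masses of all
  -- later boxes from below.
  have hright : Filter.Tendsto (fun m =>
      ENNReal.ofReal ((∫ x in orthantBox n m, g x ∂μ) ^ 2) / μ (orthantBox n 0)
        + ∫⁻ x, ENNReal.ofReal (∑ i, x i ^ 2 / a i * |partialD i g x| ^ 2) ∂μ) Filter.atTop
      (nhds (ENNReal.ofReal (0 ^ 2) / μ (orthantBox n 0)
        + ∫⁻ x, ENNReal.ofReal (∑ i, x i ^ 2 / a i * |partialD i g x| ^ 2) ∂μ)) :=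
    (ENNReal.Tendsto.div_const (ENNReal.tendsto_ofReal (hmeanlim.pow 2)) (Or.inr hμ0)).add
      tendsto_const_nhds
  have := le_of_tendsto_of_tendsto' hleft hright fun m =>
    (brascampLieb_orthantBox ha hg hW hmid m).trans (add_le_add
      (ENNReal.div_le_div_left (measure_mono (monotone_orthantBox (Nat.zero_le m))) _)
      (setLIntegral_le_lintegral _ _))
  simpa using this

/-! ### The power change of variables. -/

/-- The coordinatewise power map. -/
noncomputable def coordPow {n : ℕ} (k : Fin n → ℝ) (y : Fin n → ℝ) : Fin n → ℝ :=
  fun i => y i ^ k i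

/-- The potential of the pull-back of `orthantMeasure φ` under the coordinatewise power map. -/
noncomputable def powPotential {n : ℕ} (k : Fin n → ℝ) (φ : (Fin n → ℝ) → ℝ) (y : Fin n → ℝ) : ℝ :=
  φ (coordPow k y) - ∑ i, Real.log (k i * y i ^ (k i - 1))

section coordPow

variable {n : ℕ} {k : Fin n → ℝ} {φ : (Fin n → ℝ) → ℝ}

theorem measurable_coordPow : Measurable (coordPow k) :=
  measurable_pi_lambda _ fun i => (measurable_pi_apply i).pow_const (k i)

theorem coordPow_mem {y : Fin n → ℝ} (hy : y ∈ posOrthant n) : coordPow k y ∈ posOrthant n :=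
  fun i => Real.rpow_pos_of_pos (hy i) _

theorem image_coordPow (hk : ∀ i, 1 < k i) : coordPow k '' posOrthant n = posOrthant n := by
  refine Set.Subset.antisymm ?_ fun x hx =>
    ⟨fun i => x i ^ (k i)⁻¹, fun i => Real.rpow_pos_of_pos (hx i) _, ?_⟩
  · rintro _ ⟨y, hy, rfl⟩
    exact coordPow_mem hy
  · ext i
    exact Real.rpow_inv_rpow (hx i).le (by linarith [hk i])

theorem injOn_coordPow (hk : ∀ i, 1 < k i) : Set.InjOn (coordPow k) (posOrthant n) := by
  intro x hx y hy h
  ext i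
  exact (Real.rpow_left_inj (hx i).le (hy i).le (by linarith [hk i])).1 (congrFun h i)

theorem contDiffAt_coordPow {y : Fin n → ℝ} (hy : y ∈ posOrthant n) :
    ContDiffAt ℝ 1 (coordPow k) y :=
  contDiffAt_pi.2 fun i => (contDiff_apply ℝ ℝ i).contDiffAt.rpow_const_of_ne (hy i).ne'

theorem hasFDerivAt_coordPow {y : Fin n → ℝ} (hy : y ∈ posOrthant n) :
    HasFDerivAt (coordPow k) (ContinuousLinearMap.pi fun i =>
      (ContinuousLinearMap.toSpanSingleton ℝ (k i * y i ^ (k i - 1))).comp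
        (ContinuousLinearMap.proj i)) y := by
  rw [hasFDerivAt_pi]
  intro i
  have h := (Real.hasDerivAt_rpow_const (p := k i) (Or.inl (hy i).ne')).hasFDerivAt.comp y
    (ContinuousLinearMap.proj (R := ℝ) (φ := fun _ : Fin n => ℝ) i).hasFDerivAt
  exact h

theorem continuousOn_coordPow : ContinuousOn (coordPow k) (posOrthant n) := fun _ hy =>
  (contDiffAt_coordPow hy).continuousAt.continuousWithinAt

theorem jacobian_pos (hk : ∀ i, 1 < k i) {y : Fin n → ℝ} (hy : y ∈ posOrthant n) (i : Fin n) :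
    0 < k i * y i ^ (k i - 1) :=
  mul_pos (by linarith [hk i]) (Real.rpow_pos_of_pos (hy i) _)

theorem continuousOn_powPotential (hk : ∀ i, 1 < k i) (hφ : ContinuousOn φ (posOrthant n)) :
    ContinuousOn (powPotential k φ) (posOrthant n) := by
  refine (hφ.comp continuousOn_coordPow fun y hy => coordPow_mem hy).sub
    (continuousOn_finsetSum _ fun i _ => ContinuousOn.log ?_ fun y hy => (jacobian_pos hk hy i).ne')
  exact continuousOn_const.mul
    ((continuous_apply i).continuousOn.rpow_const fun y hy => Or.inl (hy i).ne')

theorem lintegral_orthantMeasure (hφ : ContinuousOn φ (posOrthant n))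
    (F : (Fin n → ℝ) → ℝ≥0∞) : ∫⁻ x, F x ∂(orthantMeasure φ)
      = ∫⁻ x in posOrthant n, ENNReal.ofReal (Real.exp (-φ x)) * F x := by
  rw [orthantMeasure, lintegral_withDensity_eq_lintegral_mul_non_measurable₀]
  · rfl
  · exact (ENNReal.continuous_ofReal.comp_continuousOn
      (Real.continuous_exp.comp_continuousOn hφ.neg)).aemeasurable isOpen_posOrthant.measurableSet
  · exact Filter.Eventually.of_forall fun x => ENNReal.ofReal_lt_top

/-- The logarithmic terms of `powPotential` are exactly the Jacobian of the power map. No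
measurability of `F` is required, so the identity applies directly to integrands built from `f` and
its partial derivatives. -/
theorem lintegral_comp_coordPow (hk : ∀ i, 1 < k i) (hφ : ContinuousOn φ (posOrthant n))
    (F : (Fin n → ℝ) → ℝ≥0∞) : ∫⁻ x, F x ∂(orthantMeasure φ)
      = ∫⁻ y, F (coordPow k y) ∂(orthantMeasure (powPotential k φ)) := by
  have hO := (isOpen_posOrthant (n := n)).measurableSet
  rw [lintegral_orthantMeasure hφ, lintegral_orthantMeasure (continuousOn_powPotential hk hφ)]
  conv_lhs => rw [← image_coordPow hk]
  rw [lintegral_image_eq_lintegral_abs_det_fderiv_mul volume hO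
    (fun y hy => (hasFDerivAt_coordPow hy).hasFDerivWithinAt) (injOn_coordPow hk)]
  refine setLIntegral_congr_fun hO fun y hy => ?_
  have hpos := jacobian_pos hk hy
  rw [ContinuousLinearMap.det_pi]
  simp only [ContinuousLinearMap.det_toSpanSingleton]
  rw [← mul_assoc, ← ENNReal.ofReal_mul (abs_nonneg _),
    abs_of_pos (Finset.prod_pos fun i _ => hpos i)]
  congr 2
  rw [powPotential, neg_sub, Real.exp_sub, Real.exp_sum,
    Finset.prod_congr rfl fun i _ => Real.exp_log (hpos i), Real.exp_neg, div_eq_mul_inv]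

theorem map_coordPow (hk : ∀ i, 1 < k i) (hφ : ContinuousOn φ (posOrthant n)) :
    (orthantMeasure (powPotential k φ)).map (coordPow k) = orthantMeasure φ := by
  ext A hA
  rw [Measure.map_apply measurable_coordPow hA, ← lintegral_indicator_one hA,
    lintegral_comp_coordPow hk hφ, ← lintegral_indicator_one (measurable_coordPow hA)]
  rfl

theorem locallyLipschitzOn_comp_coordPow {f : (Fin n → ℝ) → ℝ}
    (hf : LocallyLipschitzOn (posOrthant n) f) :
    LocallyLipschitzOn (posOrthant n) fun y => f (coordPow k y) := by
  intro y hy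
  obtain ⟨K, s, hs, hK⟩ := hf (coordPow_mem (k := k) hy)
  obtain ⟨K', s', hs', hK'⟩ := (contDiffAt_coordPow (k := k) hy).exists_lipschitzOnWith
  rw [isOpen_posOrthant.nhdsWithin_eq (coordPow_mem hy)] at hs
  refine ⟨K * K', s' ∩ coordPow k ⁻¹' s, mem_nhdsWithin_of_mem_nhds (Filter.inter_mem hs'
    ((contDiffAt_coordPow hy).continuousAt.preimage_mem_nhds hs)), ?_⟩
  exact hK.comp (hK'.mono Set.inter_subset_left) fun x hx => hx.2

theorem partialD_comp_coordPow {f : (Fin n → ℝ) → ℝ} {y : Fin n → ℝ} (hy : y ∈ posOrthant n)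
    (hf : DifferentiableAt ℝ f (coordPow k y)) (i : Fin n) :
    partialD i (fun y => f (coordPow k y)) y
      = k i * y i ^ (k i - 1) * partialD i f (coordPow k y) := by
  have h := hf.hasFDerivAt.comp y (hasFDerivAt_coordPow hy)
  unfold partialD
  rw [h.differentiableAt.lineDeriv_eq_fderiv (f := fun y => f (coordPow k y)),
    hf.lineDeriv_eq_fderiv, show fderiv ℝ (fun y => f (coordPow k y)) y = _ from h.fderiv,
    ← smul_eq_mul, ← map_smul]
  simp only [ContinuousLinearMap.comp_apply]
  congr 1
  ext j
  rcases eq_or_ne j i with rfl | hj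
  · simp
  · simp [hj]

/-- Apply `log s ≤ s - 1` to `s = x y / m ^ 2` with `m` the midpoint: `1 - s` is exactly the square
on the left. -/
theorem log_midpoint_add_sq_le {x y : ℝ} (hx : 0 < x) (hy : 0 < y) :
    Real.log x + Real.log y + ((x - y) / (x + y)) ^ 2 ≤ 2 * Real.log ((1 / 2 : ℝ) * (x + y)) := by
  have hs : 0 < x + y := by positivity
  have h := Real.log_le_sub_one_of_pos (x := x * y / ((1 / 2 : ℝ) * (x + y)) ^ 2) (by positivity)
  rw [Real.log_div (by positivity) (by positivity), Real.log_mul hx.ne' hy.ne', Real.log_pow] at h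
  have e : x * y / ((1 / 2 : ℝ) * (x + y)) ^ 2 - 1 = -((x - y) / (x + y)) ^ 2 := by
    field_simp
    ring
  rw [e] at h
  push_cast at h
  linarith

/-- The convex part contributes a nonnegative gain; the quantitative gain, with constant `k i - 1`,
comes entirely from the logarithm of the Jacobian. -/
theorem powPotential_midpoint (hk : ∀ i, 1 < k i)
    (hconv : ConvexOn ℝ (posOrthant n) (fun x => φ (coordPow k x))) {x y : Fin n → ℝ}
    (hx : x ∈ posOrthant n) (hy : y ∈ posOrthant n) :
    2 * powPotential k φ ((1 / 2 : ℝ) • (x + y))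
      + ∑ i, (k i - 1) * ((x i - y i) / (x i + y i)) ^ 2
      ≤ powPotential k φ x + powPotential k φ y := by
  have h1 := hconv.2 hx hy (by norm_num : (0 : ℝ) ≤ 1 / 2) (by norm_num : (0 : ℝ) ≤ 1 / 2)
    (by norm_num)
  rw [← smul_add, smul_eq_mul, smul_eq_mul] at h1
  have hlog : ∀ {w : Fin n → ℝ}, w ∈ posOrthant n → ∀ i,
      Real.log (k i * w i ^ (k i - 1)) = Real.log (k i) + (k i - 1) * Real.log (w i) := by
    intro w hw i
    rw [Real.log_mul (by linarith [hk i]) (Real.rpow_pos_of_pos (hw i) _).ne',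
      Real.log_rpow (hw i)]
  have hz : (1 / 2 : ℝ) • (x + y) ∈ posOrthant n := fun i => by
    have := hx i
    have := hy i
    simp only [Pi.smul_apply, Pi.add_apply, smul_eq_mul]
    positivity
  have h2 : ∑ i, Real.log (k i * x i ^ (k i - 1)) + ∑ i, Real.log (k i * y i ^ (k i - 1))
      + ∑ i, (k i - 1) * ((x i - y i) / (x i + y i)) ^ 2
      ≤ 2 * ∑ i, Real.log (k i * ((1 / 2 : ℝ) • (x + y)) i ^ (k i - 1)) := by
    rw [← Finset.sum_add_distrib, ← Finset.sum_add_distrib, Finset.mul_sum]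
    refine Finset.sum_le_sum fun i _ => ?_
    rw [hlog hx, hlog hy, hlog hz]
    have h := mul_le_mul_of_nonneg_left (log_midpoint_add_sq_le (hx i) (hy i))
      (by linarith [hk i] : 0 ≤ k i - 1)
    simp only [Pi.smul_apply, Pi.add_apply, smul_eq_mul]
    linarith
  unfold powPotential
  linarith

end coordPow

/-! ### Conclusion: transfer back to `f`. -/

theorem theorem6p1 (n : ℕ) (hn : 1 ≤ n) (k : Fin n → ℝ) (hk : ∀ i, 1 < k i)
    (φ : (Fin n → ℝ) → ℝ) (hφ : ContDiffOn ℝ ∞ φ (posOrthant n))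
    (hconv : ConvexOn ℝ (posOrthant n) (fun x => φ (fun i => x i ^ k i)))
    (f : (Fin n → ℝ) → ℝ) (hlip : LocallyLipschitzOn (posOrthant n) f)
    (hint : Integrable f (orthantMeasure φ))
    (hmean : ∫ x, f x ∂(orthantMeasure φ) = 0) :
    ∫⁻ x, ENNReal.ofReal (f x ^ 2) ∂(orthantMeasure φ) ≤
      ∫⁻ x, ENNReal.ofReal
        (∑ i, k i ^ 2 / (k i - 1) * x i ^ 2 * |partialD i f x| ^ 2) ∂(orthantMeasure φ) := by
  have hφc := hφ.continuousOn
  have hmap := map_coordPow hk hφc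
  have hΦ := (measurable_coordPow (k := k)).aemeasurable
    (μ := orthantMeasure (powPotential k φ))
  have hint' : Integrable (fun y => f (coordPow k y)) (orthantMeasure (powPotential k φ)) := by
    rw [← hmap] at hint
    exact hint.comp_aemeasurable hΦ
  have hmean' : ∫ y, f (coordPow k y) ∂(orthantMeasure (powPotential k φ)) = 0 := by
    rw [← hmap] at hint hmean
    rw [← integral_map hΦ hint.aestronglyMeasurable, hmean]
  have key := brascampLieb_orthant (a := fun i => k i - 1) (fun i => by linarith [hk i])
    (locallyLipschitzOn_comp_coordPow hlip) (continuousOn_powPotential hk hφc)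
    (fun x hx y hy => powPotential_midpoint hk hconv hx hy) hint' hmean'
  rw [lintegral_comp_coordPow hk hφc, lintegral_comp_coordPow hk hφc]
  refine key.trans (le_of_eq ?_)
  have hmem : ∀ ψ : (Fin n → ℝ) → ℝ, orthantMeasure ψ ≪ volume.restrict (posOrthant n) := fun ψ =>
    withDensity_absolutelyContinuous _ _
  have hae : ∀ᵐ x ∂(orthantMeasure φ), DifferentiableAt ℝ f x :=
    (hmem φ).ae_le ((ae_restrict_iff' isOpen_posOrthant.measurableSet).2
      (ae_differentiableAt_of_locallyLipschitzOn hlip))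
  -- Differentiability of `f` at almost every `x` is pulled back to almost every `y`, where the
  -- chain rule is needed.
  rw [← hmap] at hae
  refine lintegral_congr_ae ?_
  filter_upwards [ae_of_ae_map hΦ hae,
    (hmem (powPotential k φ)).ae_le (ae_restrict_mem isOpen_posOrthant.measurableSet)] with y hf hy
  congr 1
  refine Finset.sum_congr rfl fun i _ => ?_
  rw [partialD_comp_coordPow hy hf, abs_mul, mul_pow, sq_abs (k i * _)]
  -- The factor `y_i` from the Brascamp-Lieb weight and `y_i ^ (k_i - 1)` from the chain rule
  -- combine to `x_i`.
  have h1 : coordPow k y i = y i * y i ^ (k i - 1) := by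
    rw [coordPow, Real.rpow_sub_one (hy i).ne']
    field_simp [(hy i).ne']
  rw [h1]
  ring
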